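/- Let $G$ be a finite simple graph with $m$ edges. An AR-labeling of $G$ is an injective map $f$ from the edge set of $G$ to the positive integers such that, for every vertex $v$ and any two distinct sets $A\neq B$ of edges incident on $v$, $\sum_{e\in A}f(e)\neq\sum_{e\in B}f(e)$. The graph $G$ is an AR-graph if it has an AR-labeling with values in $\{1,2,\dots,m\}$. For $n\ge 1$ let $S_n$ be the Sierpiński gasket graph: start with an equilateral triangle and perform $n-1$ subdivision steps, each of which replaces every triangle by the three corner triangles cut off by its midlines; the vertices of $S_n$ are the corners of the resulting $3^{n-1}$ small triangles, and its edges are the sides of these small triangles (so $S_1$ is a triangle, and $S_n$ has $3^n$ edges). Then $S_n$ is an AR-graph for every integer $n\ge 1$. -/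

import Mathlib

/-- A vertex `v` is an AR-vertex under the edge labeling `f` if distinct sets of edges incident
on `v` have distinct label sums. -/
def IsARVertex {V : Type*} (G : SimpleGraph V) (f : G.edgeSet → ℕ) (v : V) : Prop :=
  ∀ A B : Finset G.edgeSet, (∀ e ∈ A, v ∈ (e : Sym2 V)) → (∀ e ∈ B, v ∈ (e : Sym2 V)) →
    A ≠ B → ∑ e ∈ A, f e ≠ ∑ e ∈ B, f e

/-- An AR-labeling is an injective edge labeling by positive integers under which every vertex
is an AR-vertex. -/
def IsARLabeling {V : Type*} (G : SimpleGraph V) (f : G.edgeSet → ℕ) : Prop :=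
  (∀ e, 1 ≤ f e) ∧ Function.Injective f ∧ ∀ v, IsARVertex G f v

/-- A finite simple graph with `m` edges is an AR-graph if it has an AR-labeling with labels
in `{1, …, m}`. -/
def IsARGraph {V : Type*} [Finite V] (G : SimpleGraph V) : Prop :=
  ∃ f : G.edgeSet → ℕ, IsARLabeling G f ∧ ∀ e, f e ∈ Finset.Icc 1 (Nat.card G.edgeSet)

/-- The small triangles of the gasket after `k` subdivision steps, scaled so that they have side
length one. The pair `(x, y)` stands for the point `x • (1, 0) + y • (1/2, √3/2)` of the plane,
and a small triangle is recorded by its lower left corner. The gasket with `k + 1` subdivision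
steps consists of three copies of the gasket with `k` steps (which has side length `2 ^ k`). -/
def gasketCells : ℕ → Finset (ℕ × ℕ)
  | 0 => {(0, 0)}
  | k + 1 => gasketCells k ∪ (gasketCells k).image (fun c => (c.1 + 2 ^ k, c.2)) ∪
      (gasketCells k).image (fun c => (c.1, c.2 + 2 ^ k))

/-- The three corners of the upright unit triangle with lower left corner `c`. -/
def cellCorners (c : ℕ × ℕ) : Finset (ℕ × ℕ) :=
  {c, (c.1 + 1, c.2), (c.1, c.2 + 1)}

/-- The vertices of `S_n` (for `n ≥ 1`): the corners of the `3 ^ (n - 1)` small triangles of the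
finite gasket with `n - 1` subdivision steps. -/
def gasketVertices (n : ℕ) : Finset (ℕ × ℕ) :=
  (gasketCells (n - 1)).biUnion cellCorners

/-- The Sierpiński gasket graph `S_n` (for `n ≥ 1`): its edges are the sides of the small
triangles of the finite gasket, so that `S_1` is a triangle. -/
def sierpinskiGasketGraph (n : ℕ) : SimpleGraph (gasketVertices n) where
  Adj u v := u ≠ v ∧ ∃ c ∈ gasketCells (n - 1),
    (u : ℕ × ℕ) ∈ cellCorners c ∧ (v : ℕ × ℕ) ∈ cellCorners c
  symm := ⟨fun _ _ h => ⟨h.1.symm, h.2.imp fun _ hc => ⟨hc.1, hc.2.2, hc.2.1⟩⟩⟩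
  loopless := ⟨fun _ h => h.1 rfl⟩

/-! ### Sign independence -/

/-- The integers `p, q, r, s` satisfy no nontrivial linear relation with coefficients
in `{-1, 0, 1}`. -/
def SignIndependent (p q r s : ℤ) : Prop :=
  ∀ a ∈ Finset.Icc (-1 : ℤ) 1, ∀ b ∈ Finset.Icc (-1 : ℤ) 1, ∀ c ∈ Finset.Icc (-1 : ℤ) 1,
    ∀ d ∈ Finset.Icc (-1 : ℤ) 1, a * p + b * q + c * r + d * s = 0 →
      a = 0 ∧ b = 0 ∧ c = 0 ∧ d = 0

theorem mem_signs_iff {a : ℤ} : a ∈ Finset.Icc (-1 : ℤ) 1 ↔ a = -1 ∨ a = 0 ∨ a = 1 := by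
  simp only [Finset.mem_Icc]; omega

theorem SignIndependent.symm {p q r s : ℤ} (h : SignIndependent p q r s) :
    SignIndependent r s p q := by
  intro a ha b hb c hc d hd e
  have := h c hc d hd a ha b hb (by linarith)
  tauto

/-- If the signs of a new relation sum to t, then 3 times the old signed sum equals x * t. When x *
t = 0, the old independence applies. Otherwise 3 divides t, so up to a global sign three
coefficients are 1 and the fourth is 0, and three positive integers would sum to x ≤ 2. -/
theorem SignIndependent.three_mul_sub {p q r s x : ℤ} (h : SignIndependent p q r s)
    (hp : 0 < p) (hq : 0 < q) (hr : 0 < r) (hs : 0 < s) (hx : 0 ≤ x) (hx2 : x ≤ 2) :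
    SignIndependent (3 * p - x) (3 * q - x) (3 * r - x) (3 * s - x) := by
  intro a ha b hb c hc d hd e
  have key := h a ha b hb c hc d hd
  rw [mem_signs_iff] at ha hb hc hd
  rcases ha with rfl | rfl | rfl <;> rcases hb with rfl | rfl | rfl <;>
    rcases hc with rfl | rfl | rfl <;> rcases hd with rfl | rfl | rfl <;> omega

/-- The coefficients of the relation are the differences of the indicators of `A` and `B`. -/
theorem SignIndependent.finset_sum_injective {p q r s : ℕ} (h : SignIndependent p q r s)
    {A B : Finset ℕ} (hA : A ⊆ {p, q, r, s}) (hB : B ⊆ {p, q, r, s})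
    (hAB : ∑ x ∈ A, x = ∑ x ∈ B, x) : A = B := by
  have hne : p ≠ q ∧ p ≠ r ∧ p ≠ s ∧ q ≠ r ∧ q ≠ s ∧ r ≠ s := by
    refine ⟨?_, ?_, ?_, ?_, ?_, ?_⟩ <;> rintro rfl
    · simpa using h 1 (by simp) (-1) (by simp) 0 (by simp) 0 (by simp) (by ring)
    · simpa using h 1 (by simp) 0 (by simp) (-1) (by simp) 0 (by simp) (by ring)
    · simpa using h 1 (by simp) 0 (by simp) 0 (by simp) (-1) (by simp) (by ring)
    · simpa using h 0 (by simp) 1 (by simp) (-1) (by simp) 0 (by simp) (by ring)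
    · simpa using h 0 (by simp) 1 (by simp) 0 (by simp) (-1) (by simp) (by ring)
    · simpa using h 0 (by simp) 0 (by simp) 1 (by simp) (-1) (by simp) (by ring)
  obtain ⟨h1, h2, h3, h4, h5, h6⟩ := hne
  have hsum : ∀ C : Finset ℕ, C ⊆ {p, q, r, s} → ((∑ x ∈ C, x : ℕ) : ℤ) =
      (if p ∈ C then 1 else 0) * p + (if q ∈ C then 1 else 0) * q +
      (if r ∈ C then 1 else 0) * r + (if s ∈ C then 1 else 0) * s := by
    intro C hC
    have : C = ({p, q, r, s} : Finset ℕ).filter (· ∈ C) := by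
      ext x
      simp only [Finset.mem_filter]
      exact ⟨fun hx => ⟨hC hx, hx⟩, fun hx => hx.2⟩
    conv_lhs => rw [this]
    rw [Finset.sum_filter, Finset.sum_insert (by simp [*]), Finset.sum_insert (by simp [*]),
      Finset.sum_insert (by simp [*]), Finset.sum_singleton]
    push_cast
    simp only [ite_mul, one_mul, zero_mul]
    ring
  have hsub := hsum A hA
  rw [hAB, hsum B hB] at hsub
  have hmem : ∀ (P R : Prop) [Decidable P] [Decidable R],
      ((if P then 1 else 0) - (if R then 1 else 0) : ℤ) ∈ Finset.Icc (-1 : ℤ) 1 := by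
    intro P R _ _
    split_ifs <;> simp
  have hiff : ∀ (P R : Prop) [Decidable P] [Decidable R],
      ((if P then 1 else 0) - (if R then 1 else 0) : ℤ) = 0 → (P ↔ R) := by
    intro P R _ _
    split_ifs <;> simp [*]
  obtain ⟨e1, e2, e3, e4⟩ := h _ (hmem (p ∈ A) (p ∈ B)) _ (hmem (q ∈ A) (q ∈ B))
    _ (hmem (r ∈ A) (r ∈ B)) _ (hmem (s ∈ A) (s ∈ B)) (by linarith)
  have e1 := hiff _ _ e1
  have e2 := hiff _ _ e2
  have e3 := hiff _ _ e3
  have e4 := hiff _ _ e4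
  ext x
  by_cases hx : x ∈ ({p, q, r, s} : Finset ℕ)
  · simp only [Finset.mem_insert, Finset.mem_singleton] at hx
    rcases hx with rfl | rfl | rfl | rfl <;> assumption
  · exact ⟨fun h => absurd (hA h) hx, fun h => absurd (hB h) hx⟩

/-- Pads the two labels at a vertex of degree 2 to a quadruple: each added number exceeds the sum of
all earlier ones. -/
theorem signIndependent_of_pair {p q : ℤ} (hp : 0 < p) (hq : 0 < q) (hpq : p ≠ q) :
    SignIndependent p q (p + q + 1) (3 * (p + q + 1)) := by
  intro a ha b hb c hc d hd e
  rw [mem_signs_iff] at ha hb hc hd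
  rcases ha with rfl | rfl | rfl <;> rcases hb with rfl | rfl | rfl <;>
    rcases hc with rfl | rfl | rfl <;> rcases hd with rfl | rfl | rfl <;> omega

/-! ### Cells and their sides -/

/-- The corners of the cell `c`: lower left, lower right, top. -/
def corner (c : ℕ × ℕ) : Fin 3 → ℕ × ℕ :=
  ![c, (c.1 + 1, c.2), (c.1, c.2 + 1)]

theorem mem_cellCorners_iff {c v : ℕ × ℕ} : v ∈ cellCorners c ↔ ∃ j, v = corner c j := by
  simp [cellCorners, corner, Fin.exists_fin_succ]

theorem corner_injective (c : ℕ × ℕ) : Function.Injective (corner c) := by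
  intro i j h
  fin_cases i <;> fin_cases j <;> simp [corner, Prod.ext_iff] at h ⊢

/-- The side of the cell `c` opposite to its corner `d`. -/
def side (c : ℕ × ℕ) (d : Fin 3) : Sym2 (ℕ × ℕ) :=
  s(corner c (d + 1), corner c (d + 2))

/-- The direction of a side determines `d`, and its position then determines the cell; so distinct
cells never share an edge. -/
theorem side_injective {c c' : ℕ × ℕ} {d d' : Fin 3} (h : side c d = side c' d') :
    c = c' ∧ d = d' := by
  obtain ⟨x, y⟩ := c
  obtain ⟨x', y'⟩ := c'
  fin_cases d <;> fin_cases d' <;>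
    simp [side, corner, Prod.ext_iff] at h ⊢ <;> omega

theorem side_eq_of_ne (c : ℕ × ℕ) {i j : Fin 3} (h : i ≠ j) :
    ∃ d, side c d = s(corner c i, corner c j) := by
  fin_cases i <;> fin_cases j <;> simp at h
  · exact ⟨2, rfl⟩
  · exact ⟨1, Sym2.eq_swap⟩
  · exact ⟨2, Sym2.eq_swap⟩
  · exact ⟨0, rfl⟩
  · exact ⟨1, rfl⟩
  · exact ⟨0, Sym2.eq_swap⟩

theorem exists_corner_of_mem_side {c v : ℕ × ℕ} {d : Fin 3} (h : v ∈ side c d) :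
    ∃ j, v = corner c j ∧ (d = j + 1 ∨ d = j + 2) := by
  rw [side, Sym2.mem_iff] at h
  rcases h with h | h
  · exact ⟨_, h, Or.inr (by fin_cases d <;> rfl)⟩
  · exact ⟨_, h, Or.inl (by fin_cases d <;> rfl)⟩

/-! ### Self-similarity of the gasket -/

/-- The translation that takes the gasket after `k` steps to its `i`-th copy in the next one. -/
def copyShift (k : ℕ) (i : Fin 3) (c : ℕ × ℕ) : ℕ × ℕ :=
  ![c, (c.1 + 2 ^ k, c.2), (c.1, c.2 + 2 ^ k)] i

theorem mem_gasketCells_succ {k : ℕ} {c : ℕ × ℕ} :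
    c ∈ gasketCells (k + 1) ↔ ∃ i, ∃ c' ∈ gasketCells k, c = copyShift k i c' := by
  simp only [gasketCells, Finset.mem_union, Finset.mem_image, Fin.exists_fin_succ, copyShift]
  simp [eq_comm, or_assoc]

theorem add_lt_of_mem_gasketCells {k : ℕ} {c : ℕ × ℕ} (h : c ∈ gasketCells k) :
    c.1 + c.2 < 2 ^ k := by
  induction k generalizing c with
  | zero => simp [gasketCells] at h; simp [h]
  | succ k ih =>
    obtain ⟨i, c', hc', rfl⟩ := mem_gasketCells_succ.1 h
    have := ih hc'
    have hk := pow_succ 2 k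
    fin_cases i <;> simp [copyShift] <;> omega

theorem corner_copyShift (k : ℕ) (i j : Fin 3) (c : ℕ × ℕ) :
    corner (copyShift k i c) j = copyShift k i (corner c j) := by
  fin_cases i <;> fin_cases j <;> simp [corner, copyShift] <;> omega

theorem copyShift_injective (k : ℕ) (i : Fin 3) : Function.Injective (copyShift k i) := by
  rintro ⟨x, y⟩ ⟨x', y'⟩ h
  fin_cases i <;> simpa [copyShift] using h

/-- The cell at the `i`-th corner of the gasket after `k` steps. -/
def cornerCell (k : ℕ) : Fin 3 → ℕ × ℕ :=
  ![(0, 0), (2 ^ k - 1, 0), (0, 2 ^ k - 1)]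

theorem cornerCell_succ (k : ℕ) (i : Fin 3) :
    cornerCell (k + 1) i = copyShift k i (cornerCell k i) := by
  have hk := pow_succ 2 k
  have := Nat.one_le_two_pow (n := k)
  fin_cases i <;> simp [cornerCell, copyShift] <;> omega

/-- Different copies of the gasket meet only in the corners at which they are glued. -/
theorem eq_cornerCell_of_corner_eq {k : ℕ} {c c' : ℕ × ℕ} (hc : c ∈ gasketCells k)
    (hc' : c' ∈ gasketCells k) {i i' j j' : Fin 3} (hi : i ≠ i')
    (h : corner (copyShift k i c) j = corner (copyShift k i' c') j') :
    c = cornerCell k i' ∧ j = i' ∧ c' = cornerCell k i ∧ j' = i := by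
  have h1 := add_lt_of_mem_gasketCells hc
  have h2 := add_lt_of_mem_gasketCells hc'
  obtain ⟨x, y⟩ := c
  obtain ⟨x', y'⟩ := c'
  fin_cases i <;> fin_cases i' <;> simp at hi <;> fin_cases j <;> fin_cases j' <;>
    simp [corner, copyShift, cornerCell] at h h1 h2 ⊢ <;> omega

theorem copy_eq_of_copyShift_eq {k : ℕ} {c c' : ℕ × ℕ} (hc : c ∈ gasketCells k)
    (hc' : c' ∈ gasketCells k) {i i' : Fin 3} (h : copyShift k i c = copyShift k i' c') :
    i = i' := by
  have h1 := add_lt_of_mem_gasketCells hc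
  have h2 := add_lt_of_mem_gasketCells hc'
  obtain ⟨x, y⟩ := c
  obtain ⟨x', y'⟩ := c'
  fin_cases i <;> fin_cases i' <;> simp [copyShift] at h h1 h2 ⊢ <;> omega

theorem card_gasketCells (k : ℕ) : (gasketCells k).card = 3 ^ k := by
  induction k with
  | zero => rfl
  | succ k ih =>
    have himage : gasketCells (k + 1) = (Finset.univ ×ˢ gasketCells k).image
        (fun a : Fin 3 × (ℕ × ℕ) => copyShift k a.1 a.2) := by
      ext c
      rw [mem_gasketCells_succ]
      simp only [Finset.mem_image, Finset.mem_product, Finset.mem_univ, true_and]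
      exact ⟨fun ⟨i, c', h, e⟩ => ⟨(i, c'), h, e.symm⟩, fun ⟨a, h, e⟩ => ⟨a.1, a.2, h, e.symm⟩⟩
    rw [himage, Finset.card_image_of_injOn, Finset.card_product, ih]
    · simp [pow_succ, mul_comm]
    · rintro ⟨i, c⟩ hc ⟨i', c'⟩ hc' h
      simp only [Finset.coe_product, Set.mem_prod, Finset.mem_coe] at hc hc' h
      obtain rfl := copy_eq_of_copyShift_eq hc.2 hc'.2 h
      rw [copyShift_injective k i h]

/-- No three cells share a vertex. -/
theorem eq_or_eq_of_corner_eq {k : ℕ} {c₁ c₂ c₃ : ℕ × ℕ} (m₁ : c₁ ∈ gasketCells k)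
    (m₂ : c₂ ∈ gasketCells k) (m₃ : c₃ ∈ gasketCells k) {j₁ j₂ j₃ : Fin 3}
    (e₂ : corner c₁ j₁ = corner c₂ j₂) (e₃ : corner c₁ j₁ = corner c₃ j₃) :
    c₁ = c₂ ∨ c₁ = c₃ ∨ c₂ = c₃ := by
  induction k generalizing c₁ c₂ c₃ j₁ j₂ j₃ with
  | zero => simp [gasketCells] at m₁ m₂; simp [m₁, m₂]
  | succ k ih =>
    obtain ⟨i₁, c₁, h₁, rfl⟩ := mem_gasketCells_succ.1 m₁
    obtain ⟨i₂, c₂, h₂, rfl⟩ := mem_gasketCells_succ.1 m₂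
    obtain ⟨i₃, c₃, h₃, rfl⟩ := mem_gasketCells_succ.1 m₃
    have e₂₃ := e₂.symm.trans e₃
    -- Two cells of one copy that meet another copy at the vertex are the same corner cell, and
    -- three distinct copies have no common point.
    by_cases h12 : i₁ = i₂
    · subst h12
      by_cases h13 : i₁ = i₃
      · subst h13
        simp only [corner_copyShift] at e₂ e₃
        rcases ih h₁ h₂ h₃ (copyShift_injective _ _ e₂) (copyShift_injective _ _ e₃) with
          rfl | rfl | rfl <;> simp
      · have a := eq_cornerCell_of_corner_eq h₁ h₃ h13 e₃
        have b := eq_cornerCell_of_corner_eq h₂ h₃ h13 e₂₃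
        exact Or.inl (by rw [a.1, b.1])
    · have a := eq_cornerCell_of_corner_eq h₁ h₂ h12 e₂
      by_cases h13 : i₁ = i₃
      · subst h13
        have b := eq_cornerCell_of_corner_eq h₃ h₂ h12 e₂₃.symm
        exact Or.inr (Or.inl (by rw [a.1, b.1]))
      · have b := eq_cornerCell_of_corner_eq h₁ h₃ h13 e₃
        by_cases h23 : i₂ = i₃
        · subst h23
          exact Or.inr (Or.inr (by rw [a.2.2.1, b.2.2.1]))
        · exact absurd (a.2.1.symm.trans b.2.1) h23

/-! ### Labelings and the base cases -/

/-- `lab c d` is a label of the side of `c` opposite to corner `d`; these labels form an AR-labeling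
of the gasket after `k` steps with values in `{1, …, 3 ^ (k + 1)}`. -/
structure IsGasketLabeling (k : ℕ) (lab : ℕ × ℕ → Fin 3 → ℕ) : Prop where
  pos : ∀ c ∈ gasketCells k, ∀ d, 1 ≤ lab c d
  le : ∀ c ∈ gasketCells k, ∀ d, lab c d ≤ 3 ^ (k + 1)
  inj : ∀ c ∈ gasketCells k, ∀ c' ∈ gasketCells k, ∀ d d', lab c d = lab c' d' → c = c' ∧ d = d'
  shared : ∀ c ∈ gasketCells k, ∀ c' ∈ gasketCells k, ∀ j j', c ≠ c' → corner c j = corner c' j' →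
    SignIndependent (lab c (j + 1)) (lab c (j + 2)) (lab c' (j' + 1)) (lab c' (j' + 2))

/-- The labels of the two edges at the `i`-th corner of the gasket. -/
def HasCornerLabels (k M : ℕ) (lab : ℕ × ℕ → Fin 3 → ℕ) : Prop :=
  ∀ i, lab (cornerCell k i) (i + 1) = (![16 * M + 8, M + 1, 4 * M + 3] : Fin 3 → ℕ) i ∧
    lab (cornerCell k i) (i + 2) = (![8 * M + 4, 11 * M + 6, 2 * M + 2] : Fin 3 → ℕ) i

/-- The label of the side `d` of `c` obtained by applying `g i` in the `i`-th copy of the gasket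
after `k` steps. -/
def glueLabels (k : ℕ) (g : Fin 3 → ℕ × ℕ → Fin 3 → ℕ) (c : ℕ × ℕ) : Fin 3 → ℕ :=
  if 2 ^ k ≤ c.1 then g 1 (c.1 - 2 ^ k, c.2)
  else if 2 ^ k ≤ c.2 then g 2 (c.1, c.2 - 2 ^ k)
  else g 0 c

theorem glueLabels_copyShift {k : ℕ} (g : Fin 3 → ℕ × ℕ → Fin 3 → ℕ) {c : ℕ × ℕ}
    (hc : c ∈ gasketCells k) (i : Fin 3) : glueLabels k g (copyShift k i c) = g i c := by
  have h := add_lt_of_mem_gasketCells hc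
  obtain ⟨x, y⟩ := c
  simp only at h
  have h1 : ¬ 2 ^ k ≤ x := by omega
  have h2 : ¬ 2 ^ k ≤ y := by omega
  fin_cases i <;> simp [copyShift, glueLabels, h1, h2]

theorem cornerCell_mem (k : ℕ) (i : Fin 3) : cornerCell k i ∈ gasketCells k := by
  induction k with
  | zero => fin_cases i <;> simp [cornerCell, gasketCells]
  | succ k ih => exact mem_gasketCells_succ.2 ⟨i, _, ih, cornerCell_succ k i⟩

theorem isGasketLabeling_zero : IsGasketLabeling 0 (fun _ d => d.val + 1) where
  pos := by simp
  le := fun _ _ d => by have := d.isLt; simp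
  inj := by
    intro c hc c' hc' d d' h
    simp only [gasketCells, Finset.mem_singleton] at hc hc'
    exact ⟨hc.trans hc'.symm, Fin.ext (by simpa using h)⟩
  shared := by
    intro c hc c' hc' j j' h
    simp only [gasketCells, Finset.mem_singleton] at hc hc'
    exact absurd (hc.trans hc'.symm) h

/-- The labels of the nine edges of the gasket after one step. -/
def gasketLabelingOne : ℕ × ℕ → Fin 3 → ℕ :=
  glueLabels 0 fun i _ => ![![9, 8, 4], ![6, 7, 1], ![3, 2, 5]] i

theorem signIndependent_glue_one {i i' : Fin 3} (h : i ≠ i') :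
    let T : Fin 3 → Fin 3 → ℕ := ![![9, 8, 4], ![6, 7, 1], ![3, 2, 5]]
    SignIndependent (T i (i' + 1)) (T i (i' + 2)) (T i' (i + 1)) (T i' (i + 2)) := by
  intro T a ha b hb c hc d hd e
  rw [mem_signs_iff] at ha hb hc hd
  fin_cases i <;> fin_cases i' <;> simp [T] at h e <;>
  rcases ha with rfl | rfl | rfl <;> rcases hb with rfl | rfl | rfl <;>
    rcases hc with rfl | rfl | rfl <;> rcases hd with rfl | rfl | rfl <;> omega

theorem isGasketLabeling_one : IsGasketLabeling 1 gasketLabelingOne := by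
  have h0 : ∀ c, c ∈ gasketCells 0 ↔ c = (0, 0) := by simp [gasketCells]
  have hlab : ∀ i, gasketLabelingOne (copyShift 0 i (0, 0)) =
      (![![9, 8, 4], ![6, 7, 1], ![3, 2, 5]] : Fin 3 → Fin 3 → ℕ) i :=
    fun i => glueLabels_copyShift _ ((h0 _).2 rfl) i
  constructor
  · intro _ hm d
    obtain ⟨i, c, hc, rfl⟩ := mem_gasketCells_succ.1 hm
    rw [(h0 c).1 hc, hlab]
    clear hm; revert i d; decide
  · intro _ hm d
    obtain ⟨i, c, hc, rfl⟩ := mem_gasketCells_succ.1 hm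
    rw [(h0 c).1 hc, hlab]
    clear hm; revert i d; decide
  · intro _ hm _ hm' d d' h
    obtain ⟨i, c, hc, rfl⟩ := mem_gasketCells_succ.1 hm
    obtain ⟨i', c', hc', rfl⟩ := mem_gasketCells_succ.1 hm'
    obtain rfl := (h0 c).1 hc
    obtain rfl := (h0 c').1 hc'
    rw [hlab, hlab] at h
    have : i = i' ∧ d = d' := by revert i i' d d'; decide
    simp [this]
  · intro _ hm _ hm' j j' hne h
    obtain ⟨i, c, hc, rfl⟩ := mem_gasketCells_succ.1 hm
    obtain ⟨i', c', hc', rfl⟩ := mem_gasketCells_succ.1 hm'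
    have hi : i ≠ i' := by
      rintro rfl
      exact hne (by rw [(h0 c).1 hc, (h0 c').1 hc'])
    obtain ⟨-, rfl, -, rfl⟩ := eq_cornerCell_of_corner_eq hc hc' hi h
    obtain rfl := (h0 c).1 hc
    obtain rfl := (h0 c').1 hc'
    rw [hlab, hlab]
    exact signIndependent_glue_one hi

theorem hasCornerLabels_one : HasCornerLabels 1 0 gasketLabelingOne := by
  intro i
  rw [cornerCell_succ, gasketLabelingOne, glueLabels_copyShift _ (cornerCell_mem 0 i)]
  revert i; decide

/-! ### The recursive step -/

/-- The labeling of the gasket after `k + 1` steps that labels the edges of the `i`-th copy of the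
previous gasket by `3 * l - i`, where `l` is the previous label. -/
def nextLabeling (k : ℕ) (lab : ℕ × ℕ → Fin 3 → ℕ) : ℕ × ℕ → Fin 3 → ℕ :=
  glueLabels k fun i c d => 3 * lab c d - i.val

set_option maxHeartbeats 1000000 in
theorem signIndependent_glue (M : ℕ) {i i' : Fin 3} (h : i ≠ i') {p q p' q' : ℕ}
    (hp : p = (![16 * M + 8, M + 1, 4 * M + 3] : Fin 3 → ℕ) i')
    (hq : q = (![8 * M + 4, 11 * M + 6, 2 * M + 2] : Fin 3 → ℕ) i')
    (hp' : p' = (![16 * M + 8, M + 1, 4 * M + 3] : Fin 3 → ℕ) i)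
    (hq' : q' = (![8 * M + 4, 11 * M + 6, 2 * M + 2] : Fin 3 → ℕ) i) :
    SignIndependent ((3 * p - i.val : ℕ) : ℤ) ((3 * q - i.val : ℕ) : ℤ)
      ((3 * p' - i'.val : ℕ) : ℤ) ((3 * q' - i'.val : ℕ) : ℤ) := by
  wlog hlt : i < i' generalizing i i' p q p' q'
  · exact (this h.symm hp' hq' hp hq (lt_of_le_of_ne (not_lt.1 hlt) h.symm)).symm
  intro a ha b hb c hc d hd e
  rw [mem_signs_iff] at ha hb hc hd
  -- Each nonzero sign pattern gives a linear equation in `M` with no solution in ℕ.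
  fin_cases i <;> fin_cases i' <;> simp at hlt hp hq hp' hq' e <;> clear h <;>
  rcases ha with rfl | rfl | rfl <;> rcases hb with rfl | rfl | rfl <;>
    rcases hc with rfl | rfl | rfl <;> rcases hd with rfl | rfl | rfl <;> omega

/-- The `i`-th corner of the new gasket is that of its `i`-th copy, so its labels change by l ↦ 3l -
i. A form aM + b is carried to a(3M + 1) + b exactly when 2b = a + i, which holds for all six forms.
-/
theorem HasCornerLabels.next {k M : ℕ} {lab : ℕ × ℕ → Fin 3 → ℕ} (h : HasCornerLabels k M lab) :
    HasCornerLabels (k + 1) (3 * M + 1) (nextLabeling k lab) := by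
  intro i
  rw [cornerCell_succ, nextLabeling, glueLabels_copyShift _ (cornerCell_mem k i)]
  simp only [h i]
  fin_cases i <;> simp <;> omega

theorem IsGasketLabeling.next {k M : ℕ} {lab : ℕ × ℕ → Fin 3 → ℕ} (h : IsGasketLabeling k lab)
    (hM : HasCornerLabels k M lab) : IsGasketLabeling (k + 1) (nextLabeling k lab) := by
  have hlab : ∀ i, ∀ c ∈ gasketCells k, ∀ d,
      nextLabeling k lab (copyShift k i c) d = 3 * lab c d - i.val := by
    intro i c hc d
    rw [nextLabeling, glueLabels_copyShift _ hc]
  constructor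
  · intro _ hm d
    obtain ⟨i, c, hc, rfl⟩ := mem_gasketCells_succ.1 hm
    have := h.pos c hc d
    rw [hlab i c hc]
    omega
  · intro _ hm d
    obtain ⟨i, c, hc, rfl⟩ := mem_gasketCells_succ.1 hm
    have := h.le c hc d
    rw [hlab i c hc, pow_succ]
    omega
  · intro _ hm _ hm' d d' e
    obtain ⟨i, c, hc, rfl⟩ := mem_gasketCells_succ.1 hm
    obtain ⟨i', c', hc', rfl⟩ := mem_gasketCells_succ.1 hm'
    rw [hlab i c hc, hlab i' c' hc'] at e
    have h1 := h.pos c hc d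
    have h2 := h.pos c' hc' d'
    -- The residue of the new label modulo 3 determines the copy.
    obtain rfl : i = i' := Fin.ext (by omega)
    obtain ⟨rfl, rfl⟩ := h.inj c hc c' hc' d d' (by omega)
    exact ⟨rfl, rfl⟩
  · intro _ hm _ hm' j j' hne e
    obtain ⟨i, c, hc, rfl⟩ := mem_gasketCells_succ.1 hm
    obtain ⟨i', c', hc', rfl⟩ := mem_gasketCells_succ.1 hm'
    simp only [hlab i c hc, hlab i' c' hc']
    by_cases hi : i = i'
    · subst hi
      rw [corner_copyShift, corner_copyShift] at e
      have key := h.shared c hc c' hc' j j' (fun h => hne (by rw [h])) (copyShift_injective _ _ e)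
      have p1 := h.pos c hc (j + 1)
      have p2 := h.pos c hc (j + 2)
      have p3 := h.pos c' hc' (j' + 1)
      have p4 := h.pos c' hc' (j' + 2)
      have cast : ∀ l : ℕ, 1 ≤ l → ((3 * l - i.val : ℕ) : ℤ) = 3 * l - (i.val : ℤ) := by omega
      rw [cast _ p1, cast _ p2, cast _ p3, cast _ p4]
      exact key.three_mul_sub (by omega) (by omega) (by omega) (by omega) (by omega) (by omega)
    · obtain ⟨rfl, rfl, rfl, rfl⟩ := eq_cornerCell_of_corner_eq hc hc' hi e
      exact signIndependent_glue M hi (hM _).1 (hM _).2 (hM _).1 (hM _).2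

theorem exists_isGasketLabeling_succ (k : ℕ) :
    ∃ lab M, IsGasketLabeling (k + 1) lab ∧ HasCornerLabels (k + 1) M lab := by
  induction k with
  | zero => exact ⟨_, 0, isGasketLabeling_one, hasCornerLabels_one⟩
  | succ k ih =>
    obtain ⟨lab, M, h, hM⟩ := ih
    exact ⟨_, _, h.next hM, hM.next⟩

theorem exists_isGasketLabeling (k : ℕ) : ∃ lab, IsGasketLabeling k lab := by
  cases k with
  | zero => exact ⟨_, isGasketLabeling_zero⟩
  | succ k =>
    obtain ⟨lab, -, h, -⟩ := exists_isGasketLabeling_succ k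
    exact ⟨lab, h⟩

/-! ### From cell labels to the graph -/

/-- The labels of the edges at a vertex are among four sign independent numbers. -/
theorem IsGasketLabeling.exists_signIndependent {k : ℕ} {lab : ℕ × ℕ → Fin 3 → ℕ}
    (h : IsGasketLabeling k lab) (v : ℕ × ℕ) : ∃ p q r s : ℕ, SignIndependent p q r s ∧
      ∀ c ∈ gasketCells k, ∀ d, v ∈ side c d → lab c d ∈ ({p, q, r, s} : Finset ℕ) := by
  by_cases h1 : ∃ c ∈ gasketCells k, ∃ j, v = corner c j
  swap
  -- Here `v` is not a vertex of the gasket, so any sign independent quadruple serves.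
  · refine ⟨1, 2, (1 + 2 + 1 : ℤ).toNat, (3 * (1 + 2 + 1) : ℤ).toNat,
      signIndependent_of_pair (by norm_num) (by norm_num) (by norm_num), ?_⟩
    intro c hc d hd
    obtain ⟨j, hj, -⟩ := exists_corner_of_mem_side hd
    exact absurd ⟨c, hc, j, hj⟩ h1
  obtain ⟨c₁, hc₁, j₁, rfl⟩ := h1
  by_cases h2 : ∃ c ∈ gasketCells k, ∃ j, c₁ ≠ c ∧ corner c₁ j₁ = corner c j
  · obtain ⟨c₂, hc₂, j₂, hne, e⟩ := h2
    refine ⟨_, _, _, _, h.shared c₁ hc₁ c₂ hc₂ j₁ j₂ hne e, ?_⟩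
    intro c hc d hd
    obtain ⟨j, hj, hd⟩ := exists_corner_of_mem_side hd
    rcases eq_or_eq_of_corner_eq hc₁ hc₂ hc e hj with h12 | rfl | rfl
    · exact absurd h12 hne
    · obtain rfl := corner_injective _ hj
      rcases hd with rfl | rfl <;> simp
    · obtain rfl := corner_injective _ (e.symm.trans hj)
      rcases hd with rfl | rfl <;> simp
  · have p1 := h.pos c₁ hc₁ (j₁ + 1)
    have p2 := h.pos c₁ hc₁ (j₁ + 2)
    have hne : lab c₁ (j₁ + 1) ≠ lab c₁ (j₁ + 2) := by
      intro e
      have := (h.inj c₁ hc₁ c₁ hc₁ _ _ e).2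
      revert this
      clear * -
      revert j₁; decide
    have key := signIndependent_of_pair (p := lab c₁ (j₁ + 1)) (q := lab c₁ (j₁ + 2))
      (by omega) (by omega) (by exact_mod_cast hne)
    refine ⟨lab c₁ (j₁ + 1), lab c₁ (j₁ + 2), lab c₁ (j₁ + 1) + lab c₁ (j₁ + 2) + 1,
      3 * (lab c₁ (j₁ + 1) + lab c₁ (j₁ + 2) + 1), by exact_mod_cast key, ?_⟩
    intro c hc d hd
    obtain ⟨j, hj, hd⟩ := exists_corner_of_mem_side hd
    obtain rfl : c₁ = c := by
      by_contra hcc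
      exact h2 ⟨c, hc, j, hcc, hj⟩
    obtain rfl := corner_injective _ hj
    rcases hd with rfl | rfl <;> simp

theorem exists_side_eq_of_mem_edgeSet (n : ℕ) (e : (sierpinskiGasketGraph n).edgeSet) :
    ∃ a : (ℕ × ℕ) × Fin 3, a.1 ∈ gasketCells (n - 1) ∧
      side a.1 a.2 = (e : Sym2 (gasketVertices n)).map Subtype.val := by
  obtain ⟨e, he⟩ := e
  induction e using Sym2.ind with
  | _ u v =>
    rw [SimpleGraph.mem_edgeSet] at he
    obtain ⟨hne, c, hc, hu, hv⟩ := he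
    obtain ⟨i, hi⟩ := mem_cellCorners_iff.1 hu
    obtain ⟨j, hj⟩ := mem_cellCorners_iff.1 hv
    have hij : i ≠ j := by
      rintro rfl
      exact hne (Subtype.ext (hi.trans hj.symm))
    obtain ⟨d, hd⟩ := side_eq_of_ne c hij
    exact ⟨(c, d), hc, by rw [hd, Sym2.map_mk]; simp [hi, hj]⟩

theorem exists_edge_map_eq_side (n : ℕ) {c : ℕ × ℕ} (hc : c ∈ gasketCells (n - 1)) (d : Fin 3) :
    ∃ e : (sierpinskiGasketGraph n).edgeSet,
      (e : Sym2 (gasketVertices n)).map Subtype.val = side c d := by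
  have hmem : ∀ j, corner c j ∈ gasketVertices n := fun j =>
    Finset.mem_biUnion.2 ⟨c, hc, mem_cellCorners_iff.2 ⟨j, rfl⟩⟩
  refine ⟨⟨s(⟨_, hmem (d + 1)⟩, ⟨_, hmem (d + 2)⟩), ?_⟩, rfl⟩
  rw [SimpleGraph.mem_edgeSet]
  refine ⟨fun h => ?_, c, hc, mem_cellCorners_iff.2 ⟨d + 1, rfl⟩,
    mem_cellCorners_iff.2 ⟨d + 2, rfl⟩⟩
  have : d + 1 = d + 2 := corner_injective c (Subtype.ext_iff.1 h)
  revert this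
  clear * -
  revert d; decide

/-- Since the left side bounds the labels, a lower bound on the number of edges suffices. -/
theorem pow_le_card_edgeSet (n : ℕ) :
    3 ^ (n - 1 + 1) ≤ Nat.card (sierpinskiGasketGraph n).edgeSet := by
  choose e he using fun a : gasketCells (n - 1) × Fin 3 => exists_edge_map_eq_side n a.1.2 a.2
  have hinj : Function.Injective e := by
    intro a b hab
    have := he a
    rw [hab, he b] at this
    obtain ⟨h1, h2⟩ := side_injective this
    exact Prod.ext (Subtype.ext h1.symm) h2.symm
  have := Nat.card_le_card_of_injective e hinj
  rwa [Nat.card_prod, Nat.card_eq_fintype_card, Fintype.card_coe, card_gasketCells, Nat.card_fin,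
    ← pow_succ] at this

theorem theorem4 (n : ℕ) (hn : 1 ≤ n) : IsARGraph (sierpinskiGasketGraph n) := by
  obtain ⟨lab, h⟩ := exists_isGasketLabeling (n - 1)
  choose a ha hside using exists_side_eq_of_mem_edgeSet n
  have hinj : Function.Injective fun e => lab (a e).1 (a e).2 := by
    intro e e' he
    obtain ⟨h1, h2⟩ := h.inj _ (ha e) _ (ha e') _ _ he
    have := hside e
    rw [h1, h2, hside e'] at this
    exact Subtype.ext (Sym2.map.injective Subtype.val_injective this.symm)
  refine ⟨fun e => lab (a e).1 (a e).2, ⟨fun e => h.pos _ (ha e) _, hinj, ?_⟩, fun e =>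
    Finset.mem_Icc.2 ⟨h.pos _ (ha e) _, (h.le _ (ha e) _).trans (pow_le_card_edgeSet n)⟩⟩
  intro v A B hA hB hne hsum
  obtain ⟨p, q, r, s, hQ, hstar⟩ := h.exists_signIndependent v
  have hsub : ∀ C : Finset (sierpinskiGasketGraph n).edgeSet,
      (∀ e ∈ C, v ∈ (e : Sym2 (gasketVertices n))) →
      C.image (fun e => lab (a e).1 (a e).2) ⊆ {p, q, r, s} := by
    intro C hC x hx
    obtain ⟨e, he, rfl⟩ := Finset.mem_image.1 hx
    refine hstar _ (ha e) _ ?_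
    rw [hside e]
    exact Sym2.mem_map.2 ⟨v, hC e he, rfl⟩
  -- As the labeling is injective, sums over edge sets become sums over sets of labels.
  refine hne (Finset.image_injective hinj (hQ.finset_sum_injective (hsub A hA) (hsub B hB) ?_))
  rwa [Finset.sum_image hinj.injOn, Finset.sum_image hinj.injOn]
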